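/- **Theorem (passive lower bound).** Let $d\ge 2$, $\alpha>0$, $\kappa>1$, $\kappa'>\kappa-1$, $\lambda\ge 1$, $0<c<2^{\kappa-2}$, $M>0$ and $\Delta_0>0$. Write $x=(\tilde x,x_d)\in[0,1]^{d-1}\times[0,1]$, and for $\beta>0$ let $\lfloor\beta\rfloor$ be the largest integer strictly smaller than $\beta$. Let $\Sigma(\lambda,\alpha)$ be the set of functions $g:[0,1]^{d-1}\to[0,1]$ that are $\lfloor\alpha\rfloor$ times continuously differentiable and satisfy $|g(x)-\mathrm{TP}_{y,\lfloor\beta\rfloor}(x)|\le\lambda\|x-y\|_\infty^\beta$ for all $x,y\in[0,1]^{d-1}$ and all $0<\beta\le\alpha$, where $\mathrm{TP}_{y,k}$ is the Taylor polynomial of $g$ of degree $k$ at $y$. Let $\mathcal P$ be the set of all laws $\mathbb P_{X,Y}$ on $[0,1]^d\times\{0,1\}$, given by a marginal law $\mathbb P_X$ and a regression function $\eta(x)=\mathbb P(Y=1\mid X=x)$, for which there is $g^*\in\Sigma(\lambda,\alpha)$ such that 1. $\{x\in[0,1]^d:\eta(x)\ge 1/2\}=\{x\in[0,1]^d: x_d\ge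 g^*(\tilde x)\}$; 2. $|\eta(x)-1/2|\ge c\,|x_d-g^*(\tilde x)|^{\kappa-1}$ for all $x\in[0,1]^d$; 3. $\displaystyle\int_{\{x\in[0,1]^d:\,|x_d-g^*(\tilde x)|\le\Delta\}}|1-2\eta(x)|\,d\mathbb P_X(x)\le M\Delta^{\kappa'}$ for all $\Delta\in[0,\Delta_0]$. For a classifier $f:[0,1]^d\to\{0,1\}$ let $\mathcal E(f)=\mathbb P_{X,Y}(f(X)\ne Y)-\mathbb P_{X,Y}(f^*(X)\ne Y)$, where $f^*=\mathbf 1\{\eta\ge 1/2\}$. Then there are $C>0$ and $N$, not depending on $n$, such that for all $n\ge N$ $$\inf_{\widehat f_n}\ \sup_{\mathbb P_{X,Y}\in\mathcal P}\ \mathbb E\big[\mathcal E(\widehat f_n)\big]\ \ge\ C\,n^{-\alpha\kappa'/(\alpha(\kappa+\kappa'-1)+d-1)},$$ where the infimum is over all classifiers $\widehat f_n$ trained on $n$ i.i.d. samples of $\mathbb P_{X,Y}$. This rate is strictly slower than the active rate $n^{-\alpha\kappa'/(2\alpha(\kappa-1)+d-1)}$, even up to logarithmic factors: $$\frac{\alpha\kappa'}{\alpha(\kappa+\kappa'-1)+d-1}<\frac{\alpha\kappa'}{2\alpha(\kappa-1)+d-1},$$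 and for every real $q$, $(\log n)^q\,n^{-\alpha\kappa'/(2\alpha(\kappa-1)+d-1)}=o\big(n^{-\alpha\kappa'/(\alpha(\kappa+\kappa'-1)+d-1)}\big)$ as $n\to\infty$. -/

import Mathlib

open MeasureTheory Set Filter Asymptotics
open scoped ENNReal Topology

noncomputable section

/-- The feature space `ℝ^{d-1} × ℝ`, in which a point is written `x = (x̃, x_d)`. -/
abbrev FeatureSpace (d : ℕ) : Type := (Fin (d - 1) → ℝ) × ℝ

/-- The unit cube `[0,1]^{d-1} × [0,1] = [0,1]^d`. -/
def unitCube (d : ℕ) : Set (FeatureSpace d) := Icc 0 1 ×ˢ Icc 0 1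

/-- The largest integer strictly smaller than `a`, for `a > 0`. -/
def strictFloor (a : ℝ) : ℕ := ⌈a⌉₊ - 1

/-- The value at `x` of the Taylor polynomial of degree `k` of `g : [0,1]^m → ℝ` at `y`. The
derivatives are those of `g` as a function on the closed cube (one-sided at its boundary). -/
def taylorPoly {m : ℕ} (k : ℕ) (g : (Fin m → ℝ) → ℝ) (y x : Fin m → ℝ) : ℝ :=
  ∑ j ∈ Finset.range (k + 1),
    (j.factorial : ℝ)⁻¹ * iteratedFDerivWithin ℝ j g (Icc 0 1) y (fun _ => x - y)

/-- The Hölder class `Σ(lam, α)` of functions `g : [0,1]^m → [0,1]`; the norm of `Fin m → ℝ` is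
the maximum norm. -/
def HolderClass (m : ℕ) (lam α : ℝ) : Set ((Fin m → ℝ) → ℝ) :=
  {g | MapsTo g (Icc 0 1) (Icc 0 1) ∧
    ContDiffOn ℝ (strictFloor α) g (Icc 0 1) ∧
    ∀ x ∈ Icc (0 : Fin m → ℝ) 1, ∀ y ∈ Icc (0 : Fin m → ℝ) 1, ∀ β : ℝ, 0 < β → β ≤ α →
      |g x - taylorPoly (strictFloor β) g y x| ≤ lam * ‖x - y‖ ^ β}

/-- The epigraph of `g` in the unit cube. -/
def epi {d : ℕ} (g : (Fin (d - 1) → ℝ) → ℝ) : Set (FeatureSpace d) :=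
  {x | x ∈ unitCube d ∧ g x.1 ≤ x.2}

/-- A binary classification problem on `[0,1]^d`, given by the marginal law of the feature and by
the regression function `η(x) = P(Y = 1 | X = x)`. -/
structure ClassificationProblem (d : ℕ) where
  /-- the law of the feature `X` -/
  marginal : Measure (FeatureSpace d)
  isProb : IsProbabilityMeasure marginal
  supported : marginal (unitCube d)ᶜ = 0
  /-- the regression function; only its values on the cube matter -/
  eta : FeatureSpace d → ℝ
  measurable_eta : Measurable eta
  eta_mem : ∀ x ∈ unitCube d, eta x ∈ Icc (0 : ℝ) 1

namespace ClassificationProblem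

variable {d : ℕ}

/-- The joint law of `(X, Y)`; the label `1` is `true` and the label `0` is `false`. -/
def joint (P : ClassificationProblem d) : Measure (FeatureSpace d × Bool) :=
  (P.marginal.withDensity fun x => ENNReal.ofReal (P.eta x)).map (fun x => (x, true)) +
  (P.marginal.withDensity fun x => ENNReal.ofReal (1 - P.eta x)).map (fun x => (x, false))

/-- The `0`-`1` risk `P(Y ≠ f(X))`. -/
def risk (P : ClassificationProblem d) (f : FeatureSpace d → Bool) : ℝ :=
  P.joint.real {z | z.2 ≠ f z.1}

/-- The Bayes classifier `1{η ≥ 1/2}`. -/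
def bayes (P : ClassificationProblem d) : FeatureSpace d → Bool :=
  fun x => decide (1 / 2 ≤ P.eta x)

/-- The excess risk of a classifier over the Bayes classifier. -/
def excessRisk (P : ClassificationProblem d) (f : FeatureSpace d → Bool) : ℝ :=
  P.risk f - P.risk P.bayes

end ClassificationProblem

/-- The class of problems on `[0,1]^d` whose decision boundary is the graph of some
`g ∈ Σ(lam, α)`, with the noise condition of exponent `κ` and constant `c`, and with the condition
of exponent `κ'` and constants `M`, `Δ₀` on the risk carried by neighbourhoods of the boundary. -/
def problemClass (d : ℕ) (lam α c κ M Δ₀ κ' : ℝ) : Set (ClassificationProblem d) :=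
  {P | ∃ g ∈ HolderClass (d - 1) lam α,
    {x | x ∈ unitCube d ∧ 1 / 2 ≤ P.eta x} = epi g ∧
    (∀ x ∈ unitCube d, c * |x.2 - g x.1| ^ (κ - 1) ≤ |P.eta x - 1 / 2|) ∧
    ∀ Δ ∈ Icc 0 Δ₀,
      ∫ x in {x | x ∈ unitCube d ∧ |x.2 - g x.1| ≤ Δ}, |1 - 2 * P.eta x| ∂P.marginal
        ≤ M * Δ ^ κ'}

/-- The passive learning rules: (jointly measurable) maps from `n` labelled samples to
classifiers. -/
def PassiveRule (d n : ℕ) : Set ((Fin n → FeatureSpace d × Bool) → FeatureSpace d → Bool) :=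
  {f | Measurable (Function.uncurry f)}

/-- The expected excess risk, under `P`, of the classifier that the rule `f` returns on `n` i.i.d.
samples of `P`. -/
def expectedExcessRisk {d n : ℕ} (P : ClassificationProblem d)
    (f : (Fin n → FeatureSpace d × Bool) → FeatureSpace d → Bool) : ℝ≥0∞ :=
  ∫⁻ D, ENNReal.ofReal (P.excessRisk (f D)) ∂(Measure.pi fun _ : Fin n => P.joint)

/-- The passive minimax expected excess risk over a class of problems. -/
def passiveMinimaxRisk {d : ℕ} (S : Set (ClassificationProblem d)) (n : ℕ) : ℝ≥0∞ :=
  ⨅ f ∈ PassiveRule d n, ⨆ P ∈ S, expectedExcessRisk P f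

/-- The exponent of the active rate. -/
def activeExponent (d : ℕ) (α κ κ' : ℝ) : ℝ := α * κ' / (2 * α * (κ - 1) + (d - 1))

/-- The exponent of the passive rate. -/
def passiveExponent (d : ℕ) (α κ κ' : ℝ) : ℝ := α * κ' / (α * (κ + κ' - 1) + (d - 1))

end

/-!
The lower bound comes from Assouad's lemma, applied to decision boundaries that follow the height
`1/2` up to a smooth bump of size `δ ≍ L^{-α}` in each of the `L^{d-1}` cells of side `1/L`, with
one bit for the direction of each bump. The marginal puts mass `w` on the points of height `1/2`
over the cell centres; there the Bayes label is the bit of the cell, with bias `ε = c δ^{κ-1}`. The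
remaining mass sits over the origin, where the bumps vanish and `η = 1/2`, so that it carries
neither information nor excess risk. The condition of exponent `κ'` holds as soon as
`w ≍ δ^{κ'-κ+1}`. Flipping a bit moves the law of one sample by a squared Hellinger distance of
order `w ε² / L^{d-1}`, so `n` samples leave a constant fraction of the bits undecided as long as
`n w ε² ≲ L^{d-1}`, that is `n ≲ L^{α(κ+κ'-1)+d-1}`. The excess risk is then of order
`w ε ≍ L^{-ακ'}`.
-/

section Taylor

variable {E F : Type*} [NormedAddCommGroup E] [NormedSpace ℝ E] [NormedAddCommGroup F]
  [NormedSpace ℝ F] {f : E → F} {n : ℕ} {C : ℝ}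

lemma norm_iteratedFDeriv_diag_le {x : E} (hC : ‖iteratedFDeriv ℝ n f x‖ ≤ C) (v : E) :
    ‖iteratedFDeriv ℝ n f x (fun _ => v)‖ ≤ C * ‖v‖ ^ n := by
  simpa only [Finset.prod_const, Finset.card_univ, Fintype.card_fin] using
    (iteratedFDeriv ℝ n f x).le_of_opNorm_le hC fun _ => v

lemma intervalIntegral_one_sub_pow (n : ℕ) : ∫ t in (0 : ℝ)..1, (1 - t) ^ n = 1 / (n + 1) := by
  simp [intervalIntegral.integral_comp_sub_left (fun t : ℝ => t ^ n) 1]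

variable [CompleteSpace F]

lemma norm_sub_taylor_succ_le (hf : ContDiff ℝ (n + 1) f)
    (hC : ∀ z, ‖iteratedFDeriv ℝ (n + 1) f z‖ ≤ C) (x y : E) :
    ‖f x - ∑ j ∈ Finset.range (n + 1), (j.factorial : ℝ)⁻¹ •
      iteratedFDeriv ℝ j f y (fun _ => x - y)‖ ≤ C * ‖x - y‖ ^ (n + 1) / (n + 1).factorial := by
  have taylor := map_add_eq_sum_add_integral_iteratedFDeriv (f := f) (x := y) (y := x - y) (n := n)
    fun t _ => hf.contDiffAt
  rw [add_sub_cancel] at taylor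
  rw [taylor, add_sub_cancel_left, norm_smul, norm_inv, Real.norm_natCast]
  have remainder : ‖∫ t in (0 : ℝ)..1, (1 - t) ^ n •
      iteratedFDeriv ℝ (n + 1) f (y + t • (x - y)) (fun _ => x - y)‖ ≤
      ∫ t in (0 : ℝ)..1, (1 - t) ^ n * (C * ‖x - y‖ ^ (n + 1)) := by
    refine intervalIntegral.norm_integral_le_of_norm_le zero_le_one (ae_of_all _ fun t ht => ?_)
      (Continuous.intervalIntegrable (by fun_prop) _ _)
    have ht' : 0 ≤ 1 - t := sub_nonneg.2 ht.2
    rw [norm_smul, Real.norm_of_nonneg (by positivity)]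
    gcongr
    exact norm_iteratedFDeriv_diag_le (hC _) _
  rw [intervalIntegral.integral_mul_const, intervalIntegral_one_sub_pow] at remainder
  refine (mul_le_mul_of_nonneg_left remainder (by positivity)).trans_eq ?_
  rw [Nat.factorial_succ]
  push_cast
  field_simp

lemma norm_sub_taylor_le_two_mul (hn : n ≠ 0) (hf : ContDiff ℝ n f)
    (hC : ∀ z, ‖iteratedFDeriv ℝ n f z‖ ≤ C) (x y : E) :
    ‖f x - ∑ j ∈ Finset.range (n + 1), (j.factorial : ℝ)⁻¹ •
      iteratedFDeriv ℝ j f y (fun _ => x - y)‖ ≤ 2 * (C * ‖x - y‖ ^ n / n.factorial) := by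
  obtain ⟨k, rfl⟩ := Nat.exists_eq_succ_of_ne_zero hn
  rw [Finset.sum_range_succ, ← sub_sub, two_mul]
  refine (norm_sub_le _ _).trans (add_le_add (norm_sub_taylor_succ_le hf hC x y) ?_)
  rw [norm_smul, norm_inv, Real.norm_natCast, div_eq_inv_mul]
  gcongr
  exact norm_iteratedFDeriv_diag_le (hC y) _

end Taylor

lemma le_mul_rpow_of_le_mul_pow {R a s β : ℝ} {k : ℕ} (ha : 0 ≤ a) (hs : 0 ≤ s) (hkβ : k ≤ β)
    (hβk : β ≤ k + 1) (hk : R ≤ a * s ^ k) (hk' : R ≤ a * s ^ (k + 1)) : R ≤ a * s ^ β := by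
  rcases le_total s 1 with h | h
  · have : s ^ (k + 1) ≤ s ^ β := by
      rw [← Real.rpow_natCast]
      exact Real.rpow_le_rpow_of_exponent_ge' hs h (k.cast_nonneg.trans hkβ) (by simpa using hβk)
    exact hk'.trans (by gcongr)
  · have : s ^ k ≤ s ^ β := by
      rw [← Real.rpow_natCast]
      exact Real.rpow_le_rpow_of_exponent_le h hkβ
    exact hk.trans (by gcongr)

section HolderClass

variable {m k : ℕ} {g : (Fin m → ℝ) → ℝ} {α β : ℝ}

lemma strictFloor_add_one (hβ : 0 < β) : strictFloor β + 1 = ⌈β⌉₊ :=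
  Nat.sub_add_cancel (Nat.ceil_pos.2 hβ)

lemma strictFloor_lt (hβ : 0 < β) : (strictFloor β : ℝ) < β :=
  Nat.lt_ceil.1 (by rw [← strictFloor_add_one hβ]; exact Nat.lt_succ_self _)

lemma le_strictFloor_add_one (hβ : 0 < β) : β ≤ (strictFloor β : ℝ) + 1 := by
  exact_mod_cast (strictFloor_add_one hβ).symm ▸ Nat.le_ceil β

lemma uniqueDiffOn_Icc_pi {ι : Type*} [Finite ι] : UniqueDiffOn ℝ (Icc (0 : ι → ℝ) 1) := by
  rw [← pi_univ_Icc]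
  exact UniqueDiffOn.univ_pi fun i => uniqueDiffOn_Icc zero_lt_one

lemma taylorPoly_eq_sum_iteratedFDeriv (hg : ContDiff ℝ k g) {y : Fin m → ℝ}
    (hy : y ∈ Icc (0 : Fin m → ℝ) 1) (x : Fin m → ℝ) :
    taylorPoly k g y x = ∑ j ∈ Finset.range (k + 1),
      (j.factorial : ℝ)⁻¹ • iteratedFDeriv ℝ j g y (fun _ => x - y) := by
  refine Finset.sum_congr rfl fun j hj => ?_
  have hjk : j ≤ k := Nat.lt_succ_iff.1 (Finset.mem_range.1 hj)
  rw [iteratedFDerivWithin_eq_iteratedFDeriv uniqueDiffOn_Icc_pi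
    (hg.of_le (by exact_mod_cast hjk)).contDiffAt hy, smul_eq_mul]

lemma abs_sub_taylorPoly_le {a b L : ℝ} (hβ : 0 < β) (hL : 0 ≤ L) (hg : ContDiff ℝ ⌈β⌉₊ g)
    (hosc : ∀ z, |g z - a| ≤ b)
    (hderiv : ∀ j ≠ 0, j ≤ ⌈β⌉₊ → ∀ z, ‖iteratedFDeriv ℝ j g z‖ ≤ b * L ^ j)
    (x : Fin m → ℝ) {y : Fin m → ℝ} (hy : y ∈ Icc (0 : Fin m → ℝ) 1) :
    |g x - taylorPoly (strictFloor β) g y x| ≤ 2 * b * (L * ‖x - y‖) ^ β := by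
  have hb : 0 ≤ b := (abs_nonneg _).trans (hosc 0)
  have hr : 0 ≤ ‖x - y‖ := norm_nonneg _
  have hβk := le_strictFloor_add_one hβ
  have hkβ := (strictFloor_lt hβ).le
  rw [← strictFloor_add_one hβ] at hg hderiv
  generalize strictFloor β = k at *
  have hgk : ContDiff ℝ k g := hg.of_le (by exact_mod_cast k.le_succ)
  rw [taylorPoly_eq_sum_iteratedFDeriv hgk hy, ← Real.norm_eq_abs]
  refine le_mul_rpow_of_le_mul_pow (by positivity) (by positivity) hkβ hβk ?_ ?_
  · rcases eq_or_ne k 0 with rfl | hk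
    · calc _ = |(g x - a) - (g y - a)| := by simp
        _ ≤ |g x - a| + |g y - a| := abs_sub _ _
        _ ≤ 2 * b * (L * ‖x - y‖) ^ 0 := by linarith [hosc x, hosc y]
    · refine (norm_sub_taylor_le_two_mul hk hgk (hderiv k hk k.le_succ) x y).trans ?_
      calc _ ≤ 2 * (b * L ^ k * ‖x - y‖ ^ k) := by
            gcongr
            exact div_le_self (by positivity) (by exact_mod_cast k.factorial_pos)
        _ = _ := by ring
  · refine (norm_sub_taylor_succ_le hg (hderiv _ k.succ_ne_zero le_rfl) x y).trans ?_
    calc _ ≤ b * L ^ (k + 1) * ‖x - y‖ ^ (k + 1) :=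
          div_le_self (by positivity) (by exact_mod_cast (k + 1).factorial_pos)
      _ = b * (L * ‖x - y‖) ^ (k + 1) := by ring
      _ ≤ _ := by gcongr; linarith

lemma mem_HolderClass_of_norm_iteratedFDeriv_le {lam B L : ℝ} (hα : 0 < α) (hL : 1 ≤ L)
    (hBlam : 2 * B ≤ lam) (hB : 2 * B ≤ 1) (hg : ContDiff ℝ ⌈α⌉₊ g)
    (hosc : ∀ z, |g z - 1 / 2| ≤ B * L ^ (-α))
    (hderiv : ∀ j ≠ 0, j ≤ ⌈α⌉₊ → ∀ z, ‖iteratedFDeriv ℝ j g z‖ ≤ B * L ^ (-α) * L ^ j) :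
    g ∈ HolderClass m lam α := by
  have hL0 : 0 < L := by linarith
  have hB0 : 0 ≤ B := nonneg_of_mul_nonneg_left ((abs_nonneg _).trans (hosc 0)) (by positivity)
  refine ⟨fun z _ => ?_, (hg.of_le ?_).contDiffOn, fun x _ y hy β hβ hβα => ?_⟩
  · have hLα : L ^ (-α) ≤ 1 := Real.rpow_le_one_of_one_le_of_nonpos hL (by linarith)
    have hz := abs_le.1 ((hosc z).trans (mul_le_of_le_one_right hB0 hLα))
    constructor <;> linarith
  · rw [← strictFloor_add_one hα]
    exact_mod_cast Nat.le_succ _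
  · have hlam : 0 ≤ lam := (by positivity : 0 ≤ 2 * B).trans hBlam
    have hceil : ⌈β⌉₊ ≤ ⌈α⌉₊ := Nat.ceil_mono hβα
    have hLβ : L ^ (-α) * L ^ β ≤ 1 := by
      rw [← Real.rpow_add hL0]
      exact Real.rpow_le_one_of_one_le_of_nonpos hL (by linarith)
    calc |g x - taylorPoly (strictFloor β) g y x|
        ≤ 2 * (B * L ^ (-α)) * (L * ‖x - y‖) ^ β :=
          abs_sub_taylorPoly_le hβ hL0.le (hg.of_le (by exact_mod_cast hceil)) hosc
            (fun j hj hjβ => hderiv j hj (hjβ.trans hceil)) x hy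
      _ = 2 * B * (L ^ (-α) * L ^ β) * ‖x - y‖ ^ β := by
          rw [Real.mul_rpow hL0.le (norm_nonneg _)]
          ring
      _ ≤ lam * 1 * ‖x - y‖ ^ β := by gcongr
      _ = lam * ‖x - y‖ ^ β := by rw [mul_one]

end HolderClass

lemma norm_sum_le_of_pairwise_disjoint {ι X F : Type*} [Fintype ι] [SeminormedAddCommGroup F]
    {S : ι → Set X} (hS : Pairwise (Function.onFun Disjoint S)) {a : ι → F} {u : X} {K : ℝ}
    (hK : 0 ≤ K) (ha : ∀ i, ‖a i‖ ≤ K) (ha0 : ∀ i, u ∉ S i → a i = 0) : ‖∑ i, a i‖ ≤ K := by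
  by_cases h : ∃ i, u ∈ S i
  · obtain ⟨i, hi⟩ := h
    have hne : ∀ j ≠ i, a j = 0 := fun j hj => ha0 j fun hu => (hS hj).notMem_of_mem_left hu hi
    rw [Fintype.sum_eq_single i hne]
    exact ha i
  · push Not at h
    rwa [Finset.sum_eq_zero fun i _ => ha0 i (h i), norm_zero]

lemma exists_norm_iteratedFDeriv_le_of_hasCompactSupport {E F : Type*} [NormedAddCommGroup E]
    [NormedSpace ℝ E] [NormedAddCommGroup F] [NormedSpace ℝ F] {f : E → F} {N : ℕ}
    (hf : ContDiff ℝ N f) (hsupp : HasCompactSupport f) :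
    ∃ K > 0, ∀ k ≤ N, ∀ v, ‖iteratedFDeriv ℝ k f v‖ ≤ K := by
  have hbound (k : ℕ) : ∃ K, k ≤ N → ∀ v, ‖iteratedFDeriv ℝ k f v‖ ≤ K := by
    by_cases hk : k ≤ N
    · obtain ⟨K, hK⟩ := (hsupp.iteratedFDeriv (𝕜 := ℝ) k).exists_bound_of_continuous
        (hf.continuous_iteratedFDeriv (by exact_mod_cast hk))
      exact ⟨K, fun _ => hK⟩
    · exact ⟨0, fun h => absurd h hk⟩
  choose K hK using hbound
  obtain ⟨M, hM⟩ := ((Finset.range (N + 1)).image K).exists_le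
  refine ⟨max M 1, by positivity, fun k hk v => (hK k hk v).trans (le_max_of_le_left ?_)⟩
  exact hM _ (Finset.mem_image_of_mem K (Finset.mem_range.2 (Nat.lt_succ_of_le hk)))

lemma norm_iteratedFDeriv_const_add_mul_comp_smul {E : Type*} [NormedAddCommGroup E]
    [NormedSpace ℝ E] {f : E → ℝ} {k : ℕ} (hf : ContDiff ℝ k f) (hk : k ≠ 0) (a δ c : ℝ) (x : E) :
    ‖iteratedFDeriv ℝ k (fun z => a + δ * f (c • z)) x‖ =
      |δ| * (|c| ^ k * ‖iteratedFDeriv ℝ k f (c • x)‖) := by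
  have hscale : ContDiff ℝ k fun z => f (c • z) := hf.comp (contDiff_const_smul c)
  have hmul : ContDiff ℝ k fun z => δ • f (c • z) := hscale.const_smul δ
  change ‖iteratedFDeriv ℝ k ((fun _ => a) + fun z => δ • f (c • z)) x‖ = _
  rw [iteratedFDeriv_add_apply contDiff_const.contDiffAt hmul.contDiffAt,
    iteratedFDeriv_const_of_ne hk, Pi.zero_apply, zero_add,
    iteratedFDeriv_const_smul_apply' hscale.contDiffAt, iteratedFDeriv_comp_const_smul c hf,
    norm_smul, norm_smul, norm_pow, Real.norm_eq_abs, Real.norm_eq_abs]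

section BumpSum

variable {E ι : Type*} [NormedAddCommGroup E] [NormedSpace ℝ E] [HasContDiffBump E] [Fintype ι]
  {φ : ContDiffBump (0 : E)} {p : ι → E} {e : ι → ℝ}

/-- The superposition of the translates of a bump `φ` to the points `p i`, with coefficients
`e i`. -/
noncomputable def bumpSum (φ : ContDiffBump (0 : E)) (p : ι → E) (e : ι → ℝ) (u : E) : ℝ :=
  ∑ i, e i * φ (u - p i)

lemma contDiff_bumpSum (n : ℕ) : ContDiff ℝ n (bumpSum φ p e) :=
  ContDiff.sum fun _ _ => contDiff_const.mul (φ.contDiff.comp (contDiff_id.sub contDiff_const))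

lemma iteratedFDeriv_bumpSum (k : ℕ) (u : E) :
    iteratedFDeriv ℝ k (bumpSum φ p e) u = ∑ i, e i • iteratedFDeriv ℝ k φ (u - p i) := by
  have hterm (i : ι) : ContDiff ℝ k fun v => φ (v - p i) :=
    φ.contDiff.comp (contDiff_id.sub contDiff_const)
  have hsum : iteratedFDeriv ℝ k (bumpSum φ p e) u =
      ∑ i, iteratedFDeriv ℝ k (fun v => e i • φ (v - p i)) u :=
    iteratedFDeriv_fun_sum_apply fun i _ => ((hterm i).const_smul (e i)).contDiffAt
  refine hsum.trans (Finset.sum_congr rfl fun i _ => ?_)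
  rw [iteratedFDeriv_const_smul_apply' (hterm i).contDiffAt, iteratedFDeriv_comp_sub]

lemma bumpSum_eq_zero {u : E} (hu : ∀ i, φ.rOut ≤ ‖u - p i‖) : bumpSum φ p e u = 0 :=
  Finset.sum_eq_zero fun i _ => by
    rw [φ.zero_of_le_dist (by rw [dist_zero_right]; exact hu i), mul_zero]

lemma bumpSum_apply_center (hp : Pairwise fun i j => φ.rOut ≤ ‖p i - p j‖) (i : ι) :
    bumpSum φ p e (p i) = e i := by
  have hne (j : ι) (hj : j ≠ i) : e j * φ (p i - p j) = 0 := by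
    rw [φ.zero_of_le_dist (by rw [dist_zero_right]; exact hp hj.symm), mul_zero]
  rw [bumpSum, Fintype.sum_eq_single i hne, sub_self,
    φ.one_of_mem_closedBall (Metric.mem_closedBall_self φ.rIn_pos.le), mul_one]

lemma norm_iteratedFDeriv_bumpSum_le (hp : Pairwise fun i j => 2 * φ.rOut < ‖p i - p j‖)
    (he : ∀ i, |e i| ≤ 1) {k : ℕ} {K : ℝ} (hK : ∀ v, ‖iteratedFDeriv ℝ k φ v‖ ≤ K) (u : E) :
    ‖iteratedFDeriv ℝ k (bumpSum φ p e) u‖ ≤ K := by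
  have hdisj : Pairwise (Function.onFun Disjoint fun i => Metric.closedBall (p i) φ.rOut) :=
    fun i j hij => Metric.closedBall_disjoint_closedBall (by
      rw [dist_eq_norm, ← two_mul]; exact hp hij)
  rw [iteratedFDeriv_bumpSum]
  refine norm_sum_le_of_pairwise_disjoint hdisj (u := u) ((norm_nonneg _).trans (hK 0))
    (fun i => ?_) fun i hi => ?_
  · rw [norm_smul]
    exact (mul_le_of_le_one_left (norm_nonneg _) (he i)).trans (hK _)
  · have hsupp : u - p i ∉ tsupport φ := by rwa [φ.tsupport_eq, mem_closedBall_zero_iff,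
      ← mem_closedBall_iff_norm]
    have hzero : iteratedFDeriv ℝ k φ (u - p i) = 0 :=
      Function.notMem_support.1 fun h => hsupp (support_iteratedFDeriv_subset k h)
    rw [hzero, smul_zero]

lemma abs_bumpSum_le (hp : Pairwise fun i j => 2 * φ.rOut < ‖p i - p j‖)
    (he : ∀ i, |e i| ≤ 1) (u : E) : |bumpSum φ p e u| ≤ 1 := by
  rw [← Real.norm_eq_abs, ← norm_iteratedFDeriv_zero (𝕜 := ℝ)]
  refine norm_iteratedFDeriv_bumpSum_le hp he (fun v => ?_) u
  rw [norm_iteratedFDeriv_zero, Real.norm_of_nonneg φ.nonneg]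
  exact φ.le_one

end BumpSum

section Boundary

variable {m L : ℕ}

/-- The centre of the cell `∏ i, [j i, j i + 1]` of the integer grid. -/
noncomputable def cellCenter (j : Fin m → Fin L) : Fin m → ℝ := fun i => (j i : ℝ) + 1 / 2

lemma one_le_norm_cellCenter_sub {j j' : Fin m → Fin L} (h : j ≠ j') :
    1 ≤ ‖cellCenter j - cellCenter j'‖ := by
  obtain ⟨i, hi⟩ := Function.ne_iff.1 h
  refine le_trans ?_ (norm_le_pi_norm _ i)
  have hne : (j i : ℤ) - (j' i : ℤ) ≠ 0 := fun h => hi (Fin.ext (by omega))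
  have habs : (1 : ℝ) ≤ |(j i : ℝ) - (j' i : ℝ)| := by exact_mod_cast Int.one_le_abs hne
  simpa [cellCenter] using habs

lemma half_le_norm_cellCenter (hm : 0 < m) (j : Fin m → Fin L) : 1 / 2 ≤ ‖cellCenter j‖ :=
  calc (1 / 2 : ℝ) ≤ cellCenter j ⟨0, hm⟩ := le_add_of_nonneg_left (Nat.cast_nonneg _)
    _ ≤ ‖cellCenter j ⟨0, hm⟩‖ := Real.le_norm_self _
    _ ≤ ‖cellCenter j‖ := norm_le_pi_norm _ _

/-- The profile of the perturbations of the boundary: a smooth bump that, centred in a unit cell,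
stays inside the cell. -/
noncomputable def unitBump (m : ℕ) : ContDiffBump (0 : Fin m → ℝ) :=
  ⟨1 / 8, 1 / 4, by norm_num, by norm_num⟩

lemma pairwise_two_mul_rOut_lt_norm_cellCenter_sub :
    Pairwise fun j j' : Fin m → Fin L =>
      2 * (unitBump m).rOut < ‖cellCenter j - cellCenter j'‖ := fun _ _ h =>
  lt_of_lt_of_le (by norm_num [unitBump]) (one_le_norm_cellCenter_sub h)

/-- The decision boundary attached to the labels `s`: the height `1/2`, with a bump of size `δ` in
each cell of side `1/L`. The bump points down where `s j` is `true`, so that `s j` is the Bayes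
label at height `1/2` over the centre of the cell `j`. -/
noncomputable def boundaryFun (δ : ℝ) (s : (Fin m → Fin L) → Bool) (x : Fin m → ℝ) : ℝ :=
  1 / 2 + δ * bumpSum (unitBump m) cellCenter (fun j => if s j then -1 else 1) ((L : ℝ) • x)

variable {δ : ℝ} {s : (Fin m → Fin L) → Bool}

lemma abs_ite_neg_one_one_le (p : Prop) [Decidable p] : |if p then (-1 : ℝ) else 1| ≤ 1 := by
  split_ifs <;> simp

lemma boundaryFun_zero (hm : 0 < m) : boundaryFun δ s 0 = 1 / 2 := by
  rw [boundaryFun, smul_zero, bumpSum_eq_zero, mul_zero, add_zero]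
  intro j
  rw [zero_sub, norm_neg]
  exact le_trans (by norm_num [unitBump]) (half_le_norm_cellCenter hm j)

lemma boundaryFun_inv_smul_cellCenter (hL : 0 < L) (j : Fin m → Fin L) :
    boundaryFun δ s ((L : ℝ)⁻¹ • cellCenter j) = if s j then 1 / 2 - δ else 1 / 2 + δ := by
  rw [boundaryFun, smul_inv_smul₀ (by positivity), bumpSum_apply_center]
  · split_ifs <;> ring
  · exact fun _ _ h => le_trans (by norm_num [unitBump]) (one_le_norm_cellCenter_sub h)

lemma contDiff_boundaryFun (n : ℕ) : ContDiff ℝ n (boundaryFun δ s) :=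
  contDiff_const.add (contDiff_const.mul
    ((contDiff_bumpSum n).comp (contDiff_const_smul (L : ℝ))))

lemma abs_boundaryFun_sub_half_le (x : Fin m → ℝ) : |boundaryFun δ s x - 1 / 2| ≤ |δ| := by
  rw [boundaryFun, add_sub_cancel_left, abs_mul]
  exact mul_le_of_le_one_right (abs_nonneg δ)
    (abs_bumpSum_le pairwise_two_mul_rOut_lt_norm_cellCenter_sub
      (fun _ => abs_ite_neg_one_one_le _) _)

lemma norm_iteratedFDeriv_boundaryFun_le {k : ℕ} {K : ℝ} (hk : k ≠ 0)
    (hK : ∀ v, ‖iteratedFDeriv ℝ k (unitBump m) v‖ ≤ K) (x : Fin m → ℝ) :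
    ‖iteratedFDeriv ℝ k (boundaryFun δ s) x‖ ≤ |δ| * (L ^ k * K) := by
  refine (norm_iteratedFDeriv_const_add_mul_comp_smul (contDiff_bumpSum k) hk _ _ _ _).trans_le ?_
  rw [Nat.abs_cast]
  gcongr
  exact norm_iteratedFDeriv_bumpSum_le pairwise_two_mul_rOut_lt_norm_cellCenter_sub
    (fun _ => abs_ite_neg_one_one_le _) hK _

lemma exists_boundaryFun_mem_HolderClass (m : ℕ) {lam α : ℝ} (hlam : 0 < lam) (hα : 0 < α) :
    ∃ A₀ > 0, ∀ A : ℝ, 0 ≤ A → A ≤ A₀ → ∀ L : ℕ, 0 < L → ∀ s : (Fin m → Fin L) → Bool,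
      boundaryFun (A * (L : ℝ) ^ (-α)) s ∈ HolderClass m lam α := by
  obtain ⟨K, -, hK⟩ := exists_norm_iteratedFDeriv_le_of_hasCompactSupport
    ((unitBump m).contDiff (n := (⌈α⌉₊ : ℕ))) (unitBump m).hasCompactSupport
  refine ⟨min lam 1 / (2 * max K 1), by positivity, fun A hA hA₀ L hL s => ?_⟩
  rw [le_div_iff₀ (by positivity)] at hA₀
  have hδ : |A * (L : ℝ) ^ (-α)| = A * (L : ℝ) ^ (-α) := abs_of_nonneg (by positivity)
  refine mem_HolderClass_of_norm_iteratedFDeriv_le (B := A * max K 1) (L := L) hα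
    (by exact_mod_cast hL) ?_ ?_ (contDiff_boundaryFun _) (fun z => ?_) fun j hj hjα z => ?_
  · linarith [min_le_left lam 1]
  · linarith [min_le_right lam 1]
  · calc |boundaryFun (A * (L : ℝ) ^ (-α)) s z - 1 / 2|
        ≤ A * 1 * (L : ℝ) ^ (-α) :=
          (abs_boundaryFun_sub_half_le z).trans_eq (by rw [hδ, mul_one])
      _ ≤ A * max K 1 * (L : ℝ) ^ (-α) := by gcongr; exact le_max_right _ _
  · calc ‖iteratedFDeriv ℝ j (boundaryFun (A * (L : ℝ) ^ (-α)) s) z‖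
        ≤ |A * (L : ℝ) ^ (-α)| * (L ^ j * max K 1) :=
          norm_iteratedFDeriv_boundaryFun_le hj (fun v => (hK j hjα v).trans (le_max_left _ _)) z
      _ = A * max K 1 * (L : ℝ) ^ (-α) * (L : ℝ) ^ j := by rw [hδ]; ring

end Boundary

section Hellinger

variable {Ω : Type*} [Fintype Ω] {P Q : Ω → ℝ}

/-- The Hellinger affinity (Bhattacharyya coefficient) of two laws on a finite space. -/
noncomputable def hellingerAffinity (P Q : Ω → ℝ) : ℝ := ∑ x, √(P x * Q x)

lemma sq_hellingerAffinity_le_two_mul_sum_min (hP : P ∈ stdSimplex ℝ Ω) (hQ : Q ∈ stdSimplex ℝ Ω) :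
    hellingerAffinity P Q ^ 2 ≤ 2 * ∑ x, min (P x) (Q x) := by
  have hmin (x : Ω) : 0 ≤ min (P x) (Q x) := le_min (hP.1 x) (hQ.1 x)
  have hmax (x : Ω) : 0 ≤ max (P x) (Q x) := le_max_of_le_left (hP.1 x)
  have hsum : ∑ x, max (P x) (Q x) ≤ 2 :=
    calc ∑ x, max (P x) (Q x) ≤ ∑ x, (P x + Q x) :=
          Finset.sum_le_sum fun x _ => max_le_add_of_nonneg (hP.1 x) (hQ.1 x)
      _ = 2 := by rw [Finset.sum_add_distrib, hP.2, hQ.2, one_add_one_eq_two]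
  calc hellingerAffinity P Q ^ 2
      = (∑ x, √(min (P x) (Q x)) * √(max (P x) (Q x))) ^ 2 := by
        simp only [hellingerAffinity, ← Real.sqrt_mul (hmin _), min_mul_max]
    _ ≤ (∑ x, √(min (P x) (Q x)) ^ 2) * ∑ x, √(max (P x) (Q x)) ^ 2 :=
        Finset.sum_mul_sq_le_sq_mul_sq _ _ _
    _ = (∑ x, min (P x) (Q x)) * ∑ x, max (P x) (Q x) := by
        simp only [Real.sq_sqrt (hmin _), Real.sq_sqrt (hmax _)]
    _ ≤ (∑ x, min (P x) (Q x)) * 2 :=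
        mul_le_mul_of_nonneg_left hsum (Finset.sum_nonneg fun x _ => hmin x)
    _ = 2 * ∑ x, min (P x) (Q x) := mul_comm _ _

lemma sum_min_le_sum_mul_ite_add_sum_mul_ite {β : Type*} [DecidableEq β] {a b : β} (hab : a ≠ b)
    (hQ : ∀ x, 0 ≤ Q x) (t : Ω → β) :
    ∑ x, min (P x) (Q x) ≤
      (∑ x, P x * if t x ≠ a then 1 else 0) + ∑ x, Q x * if t x ≠ b then 1 else 0 := by
  rw [← Finset.sum_add_distrib]
  refine Finset.sum_le_sum fun x _ => ?_
  by_cases h : t x = a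
  · simp [h, hab]
  · rw [if_pos h, mul_one]
    exact (min_le_left _ _).trans (le_add_of_nonneg_right
      (mul_nonneg (hQ x) (by split_ifs <;> simp)))

/-- The law of `n` independent draws from a law `p` on a finite space. -/
def productLaw (p : Ω → ℝ) (n : ℕ) (D : Fin n → Ω) : ℝ := ∏ k, p (D k)

lemma productLaw_mem_stdSimplex (hP : P ∈ stdSimplex ℝ Ω) (n : ℕ) :
    productLaw P n ∈ stdSimplex ℝ (Fin n → Ω) :=
  ⟨fun _ => Finset.prod_nonneg fun _ _ => hP.1 _, by
    simp only [productLaw, ← Fintype.sum_pow, hP.2, one_pow]⟩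

lemma hellingerAffinity_productLaw (hP : ∀ x, 0 ≤ P x) (hQ : ∀ x, 0 ≤ Q x) (n : ℕ) :
    hellingerAffinity (productLaw P n) (productLaw Q n) = hellingerAffinity P Q ^ n := by
  simp only [hellingerAffinity, productLaw, Fintype.sum_pow, ← Finset.prod_mul_distrib]
  exact Finset.sum_congr rfl fun D _ => Real.sqrt_prod _ fun k _ => mul_nonneg (hP _) (hQ _)

end Hellinger

section Assouad

variable {J Ω : Type*} [DecidableEq J] [Fintype Ω] {a : ℝ} {P : (J → Bool) → Ω → ℝ}

/-- The vertex of the cube `J → Bool` adjacent to `s` along the direction `j`. -/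
def flipAt (j : J) (s : J → Bool) : J → Bool := Function.update s j (!s j)

lemma flipAt_involutive (j : J) : Function.Involutive (flipAt j) := fun s => by simp [flipAt]

lemma half_le_sum_mul_ite_add_flipAt (hP : ∀ s, P s ∈ stdSimplex ℝ Ω)
    (ha : ∀ s j, a ≤ hellingerAffinity (P s) (P (flipAt j s)) ^ 2) (t : Ω → J → Bool)
    (j : J) (s : J → Bool) :
    a / 2 ≤ (∑ ω, P s ω * if t ω j ≠ s j then 1 else 0) +
      ∑ ω, P (flipAt j s) ω * if t ω j ≠ flipAt j s j then 1 else 0 := by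
  have hlecam := (ha s j).trans (sq_hellingerAffinity_le_two_mul_sum_min (hP _) (hP _))
  have htest := sum_min_le_sum_mul_ite_add_sum_mul_ite (a := s j) (b := flipAt j s j)
    (by simp [flipAt]) (P := P s) (hP (flipAt j s)).1 fun ω => t ω j
  linarith

lemma card_mul_le_sum_sum_mul_ite [Fintype J] (hP : ∀ s, P s ∈ stdSimplex ℝ Ω)
    (ha : ∀ s j, a ≤ hellingerAffinity (P s) (P (flipAt j s)) ^ 2) (t : Ω → J → Bool) (j : J) :
    Fintype.card (J → Bool) * (a / 4) ≤ ∑ s, ∑ ω, P s ω * if t ω j ≠ s j then 1 else 0 := by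
  have hflip : ∑ s, ∑ ω, P (flipAt j s) ω * (if t ω j ≠ flipAt j s j then 1 else 0) =
      ∑ s, ∑ ω, P s ω * if t ω j ≠ s j then 1 else 0 :=
    Equiv.sum_comp (flipAt_involutive j).toPerm fun s => ∑ ω, P s ω * if t ω j ≠ s j then 1 else 0
  have hpair := Finset.sum_le_sum fun s (_ : s ∈ Finset.univ) =>
    half_le_sum_mul_ite_add_flipAt hP ha t j s
  rw [Finset.sum_add_distrib, hflip, Finset.sum_const, Finset.card_univ, nsmul_eq_mul] at hpair
  linarith

lemma exists_card_mul_le_sum_mul_hammingDist [Fintype J] (hP : ∀ s, P s ∈ stdSimplex ℝ Ω)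
    (ha : ∀ s j, a ≤ hellingerAffinity (P s) (P (flipAt j s)) ^ 2) (t : Ω → J → Bool) :
    ∃ s, Fintype.card J * (a / 4) ≤ ∑ ω, P s ω * hammingDist (t ω) s := by
  have hsum : ∑ _s : J → Bool, Fintype.card J * (a / 4) ≤
      ∑ s, ∑ j, ∑ ω, P s ω * if t ω j ≠ s j then 1 else 0 := by
    rw [Finset.sum_comm]
    calc ∑ _s : J → Bool, Fintype.card J * (a / 4)
        = ∑ _j : J, Fintype.card (J → Bool) * (a / 4) := by
          simp only [Finset.sum_const, Finset.card_univ, nsmul_eq_mul, mul_left_comm]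
      _ ≤ _ := Finset.sum_le_sum fun j _ => card_mul_le_sum_sum_mul_ite hP ha t j
  obtain ⟨s, -, hs⟩ := Finset.exists_le_of_sum_le Finset.univ_nonempty hsum
  refine ⟨s, hs.trans_eq ?_⟩
  rw [Finset.sum_comm]
  simp only [← Finset.mul_sum, hammingDist, Finset.natCast_card_filter]

end Assouad

section LabelLaw

variable {I : Type*} {q η η' : I → ℝ}

/-- The joint law of `(X, Y)` when `X` has the law `q` and `Y` is `true` with conditional
probability `η X`. -/
def labelLaw (q η : I → ℝ) (x : I × Bool) : ℝ := q x.1 * if x.2 then η x.1 else 1 - η x.1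

lemma labelLaw_nonneg (hq : ∀ i, 0 ≤ q i) (hη : ∀ i, η i ∈ Icc (0 : ℝ) 1) (x : I × Bool) :
    0 ≤ labelLaw q η x := by
  refine mul_nonneg (hq _) ?_
  split_ifs
  exacts [(hη _).1, sub_nonneg.2 (hη _).2]

variable [Fintype I]

lemma labelLaw_mem_stdSimplex (hq : q ∈ stdSimplex ℝ I) (hη : ∀ i, η i ∈ Icc (0 : ℝ) 1) :
    labelLaw q η ∈ stdSimplex ℝ (I × Bool) :=
  ⟨labelLaw_nonneg hq.1 hη, by simp [Fintype.sum_prod_type, labelLaw, ← mul_add, hq.2]⟩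

lemma hellingerAffinity_labelLaw (hq : ∀ i, 0 ≤ q i) :
    hellingerAffinity (labelLaw q η) (labelLaw q η') =
      ∑ i, q i * (√(η i * η' i) + √((1 - η i) * (1 - η' i))) := by
  have hsqrt (i : I) (x y : ℝ) : √(q i * x * (q i * y)) = q i * √(x * y) := by
    rw [mul_mul_mul_comm, Real.sqrt_mul (mul_self_nonneg _), Real.sqrt_mul_self (hq i)]
  simp [hellingerAffinity, Fintype.sum_prod_type, labelLaw, hsqrt, mul_add]

lemma one_sub_mul_le_hellingerAffinity_labelLaw {i₀ : I} {a : ℝ}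
    (hq : q ∈ stdSimplex ℝ I) (hη : ∀ i, η i ∈ Icc (0 : ℝ) 1) (hne : ∀ i ≠ i₀, η' i = η i)
    (ha : 1 - a ≤ √(η i₀ * η' i₀) + √((1 - η i₀) * (1 - η' i₀))) :
    1 - q i₀ * a ≤ hellingerAffinity (labelLaw q η) (labelLaw q η') := by
  classical
  have hterm (i : I) : q i * (1 - if i = i₀ then a else 0) ≤
      q i * (√(η i * η' i) + √((1 - η i) * (1 - η' i))) := by
    refine mul_le_mul_of_nonneg_left ?_ (hq.1 i)
    split_ifs with h
    · rwa [h]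
    · rw [hne i h, Real.sqrt_mul_self (hη i).1, Real.sqrt_mul_self (sub_nonneg.2 (hη i).2)]
      linarith
  rw [hellingerAffinity_labelLaw hq.1]
  refine le_trans (le_of_eq ?_) (Finset.sum_le_sum fun i _ => hterm i)
  simp [mul_sub, Finset.sum_sub_distrib, hq.2]

end LabelLaw

section Sites

variable {J : Type*} {w ε : ℝ}

/-- The regression function on the sites of the hypercube construction: bias `ε` towards the label
`s j` at the site `j`, none at the extra site `none`. -/
noncomputable def siteEta (ε : ℝ) (s : J → Bool) : Option J → ℝ
  | none => 1 / 2
  | some j => if s j then 1 / 2 + ε else 1 / 2 - ε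

lemma siteEta_mem_Icc (hε : ε ∈ Icc (0 : ℝ) (1 / 2)) (s : J → Bool) (i : Option J) :
    siteEta ε s i ∈ Icc (0 : ℝ) 1 := by
  obtain ⟨hε0, hε1⟩ := hε
  cases i with
  | none => norm_num [siteEta]
  | some j =>
    simp only [siteEta]
    split_ifs <;> constructor <;> linarith

lemma abs_one_sub_two_mul_siteEta_some (hε : 0 ≤ ε) (s : J → Bool) (j : J) :
    |1 - 2 * siteEta ε s (some j)| = 2 * ε := by
  rw [siteEta]
  split_ifs
  · rw [abs_of_nonpos] <;> linarith
  · rw [abs_of_nonneg] <;> linarith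

lemma siteEta_flipAt_of_ne [DecidableEq J] {j : J} {i : Option J} (hi : i ≠ some j)
    (s : J → Bool) : siteEta ε (flipAt j s) i = siteEta ε s i := by
  cases i with
  | none => rfl
  | some i =>
    have hij : i ≠ j := fun h => hi (congrArg some h)
    simp only [siteEta, flipAt, Function.update_of_ne hij]

lemma one_sub_le_sqrt_add_sqrt_siteEta_flipAt [DecidableEq J] (hε : ε ∈ Icc (0 : ℝ) (1 / 2))
    (s : J → Bool) (j : J) :
    1 - 4 * ε ^ 2 ≤ √(siteEta ε s (some j) * siteEta ε (flipAt j s) (some j)) +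
      √((1 - siteEta ε s (some j)) * (1 - siteEta ε (flipAt j s) (some j))) := by
  have hsqrt : 1 / 2 - 2 * ε ^ 2 ≤ √(1 / 4 - ε ^ 2) := by
    have hε2 : ε ^ 2 ≤ (1 / 2) ^ 2 := pow_le_pow_left₀ hε.1 hε.2 2
    exact Real.le_sqrt_of_sq_le (by nlinarith [sq_nonneg ε])
  have hprod : siteEta ε s (some j) * siteEta ε (flipAt j s) (some j) = 1 / 4 - ε ^ 2 := by
    cases h : s j <;> simp [siteEta, flipAt, h] <;> ring
  have hprod' : (1 - siteEta ε s (some j)) * (1 - siteEta ε (flipAt j s) (some j)) =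
      1 / 4 - ε ^ 2 := by
    cases h : s j <;> simp [siteEta, flipAt, h] <;> ring
  rw [hprod, hprod']
  linarith

variable [Fintype J]

/-- The law of the site: mass `w` spread uniformly over `J`, and the rest at `none`. -/
noncomputable def siteWeight (w : ℝ) : Option J → ℝ
  | none => 1 - w
  | some _ => w / Fintype.card J

variable [Nonempty J]

lemma sum_siteWeight_some (w : ℝ) : ∑ j : J, siteWeight w (some j) = w := by
  simp [siteWeight, mul_div_cancel₀]

lemma siteWeight_mem_stdSimplex (hw : w ∈ Icc (0 : ℝ) 1) :
    siteWeight w ∈ stdSimplex ℝ (Option J) := by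
  refine ⟨fun i => ?_, ?_⟩
  · cases i with
    | none => exact sub_nonneg.2 hw.2
    | some j => exact div_nonneg hw.1 (Nat.cast_nonneg _)
  · rw [Fintype.sum_option, sum_siteWeight_some, siteWeight, sub_add_cancel]

lemma half_le_sq_hellingerAffinity_productLaw_flipAt [DecidableEq J] {n : ℕ}
    (hw : w ∈ Icc (0 : ℝ) 1) (hε : ε ∈ Icc (0 : ℝ) (1 / 2))
    (hn : 16 * (n * (w * ε ^ 2)) ≤ Fintype.card J) (s : J → Bool) (j : J) :
    1 / 2 ≤ hellingerAffinity (productLaw (labelLaw (siteWeight w) (siteEta ε s)) n)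
      (productLaw (labelLaw (siteWeight w) (siteEta ε (flipAt j s))) n) ^ 2 := by
  have hq := siteWeight_mem_stdSimplex (J := J) hw
  have hlaw (s : J → Bool) := labelLaw_mem_stdSimplex hq (siteEta_mem_Icc hε s)
  have hcard : (1 : ℝ) ≤ Fintype.card J := by exact_mod_cast Fintype.card_pos
  set x : ℝ := w / Fintype.card J * (4 * ε ^ 2) with hx
  have haff : 1 - x ≤ hellingerAffinity (labelLaw (siteWeight w) (siteEta ε s))
      (labelLaw (siteWeight w) (siteEta ε (flipAt j s))) :=
    one_sub_mul_le_hellingerAffinity_labelLaw hq (siteEta_mem_Icc hε s)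
      (fun _ hi => siteEta_flipAt_of_ne hi s) (one_sub_le_sqrt_add_sqrt_siteEta_flipAt hε s j)
  have hx1 : x ≤ 1 := by
    have hε2 : ε ^ 2 ≤ (1 / 2) ^ 2 := pow_le_pow_left₀ hε.1 hε.2 2
    exact mul_le_one₀ (div_le_one_of_le₀ (hw.2.trans hcard) (by positivity)) (by positivity)
      (by linarith)
  have hnx : (n * 2 : ℕ) * x ≤ 1 / 2 := by
    rw [hx, div_mul_eq_mul_div, ← mul_div_assoc, div_le_iff₀ (by linarith)]
    push_cast
    linarith
  rw [hellingerAffinity_productLaw (hlaw s).1 (hlaw _).1, ← pow_mul]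
  calc 1 / 2 ≤ 1 + (n * 2 : ℕ) * -x := by linarith
    _ ≤ (1 + -x) ^ (n * 2) := one_add_mul_le_pow (by linarith) _
    _ ≤ _ := pow_le_pow_left₀ (by linarith) (by linarith) _

lemma exists_card_div_eight_le_sum_mul_hammingDist {n : ℕ} (hw : w ∈ Icc (0 : ℝ) 1)
    (hε : ε ∈ Icc (0 : ℝ) (1 / 2)) (hn : 16 * (n * (w * ε ^ 2)) ≤ Fintype.card J)
    (t : (Fin n → Option J × Bool) → J → Bool) :
    ∃ s, (Fintype.card J : ℝ) / 8 ≤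
      ∑ D, productLaw (labelLaw (siteWeight w) (siteEta ε s)) n D * hammingDist (t D) s := by
  classical
  obtain ⟨s, hs⟩ := exists_card_mul_le_sum_mul_hammingDist
    (fun s => productLaw_mem_stdSimplex (labelLaw_mem_stdSimplex (siteWeight_mem_stdSimplex hw)
      (siteEta_mem_Icc hε s)) n) (half_le_sq_hellingerAffinity_productLaw_flipAt hw hε hn) t
  exact ⟨s, by linarith⟩

end Sites

section DiscreteMeasure

variable {I X : Type*} [Fintype I] [MeasurableSpace X] {q : I → ℝ} {pt : I → X}

/-- The measure with mass `q i` at the point `pt i`. -/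
noncomputable def discreteMeasure (q : I → ℝ) (pt : I → X) : Measure X :=
  ∑ i, ENNReal.ofReal (q i) • Measure.dirac (pt i)

instance : IsFiniteMeasure (discreteMeasure q pt) :=
  ⟨by simp [discreteMeasure, Measure.finsetSum_apply, ENNReal.sum_lt_top]⟩

variable [MeasurableSingletonClass X]

lemma discreteMeasure_apply (A : Set X) :
    discreteMeasure q pt A = ∑ i, ENNReal.ofReal (q i) * A.indicator 1 (pt i) := by
  simp [discreteMeasure, Measure.finsetSum_apply]

lemma discreteMeasure_real_apply (hq : ∀ i, 0 ≤ q i) (A : Set X) :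
    (discreteMeasure q pt).real A = ∑ i, q i * A.indicator 1 (pt i) := by
  rw [Measure.real, discreteMeasure_apply, ENNReal.toReal_sum]
  · refine Finset.sum_congr rfl fun i _ => ?_
    by_cases h : pt i ∈ A <;> simp [h, hq i]
  · intro i _
    by_cases h : pt i ∈ A <;> simp [h]

lemma isProbabilityMeasure_discreteMeasure (hq : q ∈ stdSimplex ℝ I) :
    IsProbabilityMeasure (discreteMeasure q pt) :=
  ⟨by simp [discreteMeasure_apply, ← ENNReal.ofReal_sum_of_nonneg fun i _ => hq.1 i, hq.2]⟩

lemma lintegral_discreteMeasure (f : X → ℝ≥0∞) :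
    ∫⁻ x, f x ∂discreteMeasure q pt = ∑ i, ENNReal.ofReal (q i) * f (pt i) := by
  simp [discreteMeasure]

lemma setIntegral_discreteMeasure (hq : ∀ i, 0 ≤ q i) (A : Set X) (f : X → ℝ) :
    ∫ x in A, f x ∂discreteMeasure q pt = ∑ i, q i * A.indicator f (pt i) := by
  classical
  rw [discreteMeasure, ← Measure.restrictₗ_apply, map_sum, integral_finsetSum_measure]
  · refine Finset.sum_congr rfl fun i _ => ?_
    rw [map_smul, integral_smul_measure, Measure.restrictₗ_apply, setIntegral_dirac,
      ENNReal.toReal_ofReal (hq i), smul_eq_mul, indicator_apply]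
  · intro i _
    rw [map_smul, Measure.restrictₗ_apply]
    exact ((integrable_dirac (by simp)).restrict).smul_measure ENNReal.ofReal_ne_top

lemma pi_discreteMeasure (hq : ∀ i, 0 ≤ q i) (n : ℕ) :
    (Measure.pi fun _ : Fin n => discreteMeasure q pt) =
      discreteMeasure (productLaw q n) fun D k => pt (D k) := by
  refine Measure.pi_eq fun A _ => ?_
  have hterm (D : Fin n → I) : ENNReal.ofReal (productLaw q n D) *
      (univ.pi A).indicator 1 (fun k => pt (D k)) =
      ∏ k, ENNReal.ofReal (q (D k)) * (A k).indicator 1 (pt (D k)) := by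
    rw [Finset.prod_mul_distrib, productLaw, ENNReal.ofReal_prod_of_nonneg fun _ _ => hq _]
    congr 1
    by_cases h : ∀ k, pt (D k) ∈ A k
    · simp [h]
    · obtain ⟨k, hk⟩ := not_forall.1 h
      rw [Finset.prod_eq_zero (Finset.mem_univ k) (by simp [hk]), indicator_of_notMem
        (by simpa using ⟨k, hk⟩)]
  simp only [discreteMeasure_apply, hterm, Finset.prod_univ_sum, Fintype.piFinset_univ]

end DiscreteMeasure

namespace ClassificationProblem

variable {d : ℕ} {I : Type*} [Fintype I] {P : ClassificationProblem d} {q : I → ℝ}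
  {pt : I → FeatureSpace d}

lemma joint_eq_discreteMeasure (hP : P.marginal = discreteMeasure q pt) (hq : ∀ i, 0 ≤ q i) :
    P.joint =
      discreteMeasure (labelLaw q fun i => P.eta (pt i)) fun x : I × Bool => (pt x.1, x.2) := by
  refine Measure.ext fun A hA => ?_
  have hlabel (b : Bool) (φ : FeatureSpace d → ℝ) :
      ((P.marginal.withDensity fun x => ENNReal.ofReal (φ x)).map (fun x => (x, b))) A =
        ∑ i, ENNReal.ofReal (q i * φ (pt i)) * A.indicator 1 (pt i, b) := by
    have hb : Measurable fun x : FeatureSpace d => (x, b) := measurable_prodMk_right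
    rw [Measure.map_apply hb hA, withDensity_apply _ (hb hA), ← lintegral_indicator (hb hA), hP,
      lintegral_discreteMeasure]
    refine Finset.sum_congr rfl fun i _ => ?_
    rw [ENNReal.ofReal_mul (hq i)]
    by_cases h : (pt i, b) ∈ A <;> simp [h]
  rw [joint, Measure.add_apply, hlabel, hlabel, discreteMeasure_apply]
  simp [Fintype.sum_prod_type, labelLaw, Finset.sum_add_distrib]

lemma risk_eq_sum (hP : P.marginal = discreteMeasure q pt) (hq : ∀ i, 0 ≤ q i)
    (hpt : ∀ i, pt i ∈ unitCube d) (f : FeatureSpace d → Bool) :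
    P.risk f = ∑ i, q i * if f (pt i) then 1 - P.eta (pt i) else P.eta (pt i) := by
  rw [risk, joint_eq_discreteMeasure hP hq, discreteMeasure_real_apply
    (labelLaw_nonneg hq fun i => P.eta_mem _ (hpt i)), Fintype.sum_prod_type]
  refine Finset.sum_congr rfl fun i _ => ?_
  cases h : f (pt i) <;> simp [h, labelLaw]

lemma excessRisk_eq_sum (hP : P.marginal = discreteMeasure q pt) (hq : ∀ i, 0 ≤ q i)
    (hpt : ∀ i, pt i ∈ unitCube d) (f : FeatureSpace d → Bool) :
    P.excessRisk f =
      ∑ i, q i * (|1 - 2 * P.eta (pt i)| * if f (pt i) ≠ P.bayes (pt i) then 1 else 0) := by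
  rw [excessRisk, risk_eq_sum hP hq hpt, risk_eq_sum hP hq hpt, ← Finset.sum_sub_distrib]
  refine Finset.sum_congr rfl fun i _ => ?_
  rw [← mul_sub]
  congr 1
  by_cases hη : 1 / 2 ≤ P.eta (pt i)
  · have hbayes : P.bayes (pt i) = true := decide_eq_true hη
    rw [abs_of_nonpos (by linarith), hbayes]
    cases f (pt i) <;> (simp; try ring)
  · have hbayes : P.bayes (pt i) = false := decide_eq_false hη
    rw [abs_of_nonneg (by linarith), hbayes]
    cases f (pt i) <;> (simp; try ring)

lemma excessRisk_nonneg (hP : P.marginal = discreteMeasure q pt) (hq : ∀ i, 0 ≤ q i)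
    (hpt : ∀ i, pt i ∈ unitCube d) (f : FeatureSpace d → Bool) : 0 ≤ P.excessRisk f := by
  rw [excessRisk_eq_sum hP hq hpt]
  exact Finset.sum_nonneg fun i _ => mul_nonneg (hq i)
    (mul_nonneg (abs_nonneg _) (by split_ifs <;> simp))

lemma expectedExcessRisk_eq_ofReal_sum (hP : P.marginal = discreteMeasure q pt)
    (hq : ∀ i, 0 ≤ q i) (hpt : ∀ i, pt i ∈ unitCube d) {n : ℕ}
    (f : (Fin n → FeatureSpace d × Bool) → FeatureSpace d → Bool) :
    expectedExcessRisk P f = ENNReal.ofReal (∑ D : Fin n → I × Bool,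
      productLaw (labelLaw q fun i => P.eta (pt i)) n D *
        P.excessRisk (f fun k => (pt (D k).1, (D k).2))) := by
  have hlaw := labelLaw_nonneg hq fun i => P.eta_mem _ (hpt i)
  have hprod (D : Fin n → I × Bool) : 0 ≤ productLaw (labelLaw q fun i => P.eta (pt i)) n D :=
    Finset.prod_nonneg fun _ _ => hlaw _
  rw [expectedExcessRisk, joint_eq_discreteMeasure hP hq, pi_discreteMeasure hlaw,
    lintegral_discreteMeasure, ENNReal.ofReal_sum_of_nonneg fun D _ =>
      mul_nonneg (hprod D) (excessRisk_nonneg hP hq hpt _)]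
  exact Finset.sum_congr rfl fun D _ => (ENNReal.ofReal_mul (hprod D)).symm

end ClassificationProblem

section Reduction

variable {d : ℕ} {J : Type*} [Fintype J] [Nonempty J] {pt : Option J → FeatureSpace d} {w ε : ℝ}

lemma excessRisk_eq_mul_hammingDist {P : ClassificationProblem d} {s : J → Bool}
    (hpt : ∀ i, pt i ∈ unitCube d) (hw : w ∈ Icc (0 : ℝ) 1) (hε : 0 < ε)
    (hP : P.marginal = discreteMeasure (siteWeight w) pt) (heta : ∀ i, P.eta (pt i) = siteEta ε s i)
    (f : FeatureSpace d → Bool) :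
    P.excessRisk f =
      w / Fintype.card J * (2 * ε) * hammingDist (fun j => f (pt (some j))) s := by
  have hnone : |1 - 2 * P.eta (pt none)| = 0 := by simp [heta, siteEta]
  have hsome (j : J) : |1 - 2 * P.eta (pt (some j))| = 2 * ε := by
    rw [heta, abs_one_sub_two_mul_siteEta_some hε.le]
  have hbayes (j : J) : P.bayes (pt (some j)) = s j := by
    cases h : s j <;> simp [ClassificationProblem.bayes, heta, siteEta, h, hε, hε.le]
  rw [P.excessRisk_eq_sum hP (siteWeight_mem_stdSimplex hw).1 hpt, Fintype.sum_option, hnone]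
  simp only [hsome, hbayes, siteWeight, zero_mul, mul_zero, zero_add, hammingDist,
    Finset.natCast_card_filter, Finset.mul_sum, mul_assoc]

lemma ofReal_le_iSup_expectedExcessRisk {S : Set (ClassificationProblem d)} {n : ℕ}
    (hpt : ∀ i, pt i ∈ unitCube d) (hw : w ∈ Icc (0 : ℝ) 1) (hε : ε ∈ Ioc (0 : ℝ) (1 / 2))
    (hn : 16 * (n * (w * ε ^ 2)) ≤ Fintype.card J)
    (hS : ∀ s, ∃ P ∈ S, P.marginal = discreteMeasure (siteWeight w) pt ∧
      ∀ i, P.eta (pt i) = siteEta ε s i)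
    (f : (Fin n → FeatureSpace d × Bool) → FeatureSpace d → Bool) :
    ENNReal.ofReal (w * ε / 4) ≤ ⨆ P ∈ S, expectedExcessRisk P f := by
  have hε' : ε ∈ Icc (0 : ℝ) (1 / 2) := Ioc_subset_Icc_self hε
  have hw0 := hw.1
  have hε0 := hε.1
  obtain ⟨s, hs⟩ := exists_card_div_eight_le_sum_mul_hammingDist hw hε' hn
    fun D j => f (fun k => (pt (D k).1, (D k).2)) (pt (some j))
  obtain ⟨P, hPS, hP, heta⟩ := hS s
  refine le_iSup₂_of_le P hPS ?_
  rw [P.expectedExcessRisk_eq_ofReal_sum hP (siteWeight_mem_stdSimplex hw).1 hpt]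
  refine ENNReal.ofReal_le_ofReal ?_
  have hcard : (Fintype.card J : ℝ) ≠ 0 := by exact_mod_cast Fintype.card_ne_zero
  calc w * ε / 4 = w / Fintype.card J * (2 * ε) * (Fintype.card J / 8) := by
        field_simp
        ring
    _ ≤ w / Fintype.card J * (2 * ε) * ∑ D, productLaw (labelLaw (siteWeight w) (siteEta ε s)) n D *
          hammingDist (fun j => f (fun k => (pt (D k).1, (D k).2)) (pt (some j))) s := by gcongr
    _ = _ := by
        rw [Finset.mul_sum]
        refine Finset.sum_congr rfl fun D _ => ?_
        rw [excessRisk_eq_mul_hammingDist hpt hw hε.1 hP heta, funext heta, mul_left_comm]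

end Reduction

section NoiseEta

variable {d : ℕ} {c κ : ℝ} {g : (Fin (d - 1) → ℝ) → ℝ}

/-- The regression function with decision boundary `g` that satisfies the noise condition with
equality. -/
noncomputable def noiseEta (c κ : ℝ) (g : (Fin (d - 1) → ℝ) → ℝ) (x : FeatureSpace d) : ℝ :=
  if g x.1 ≤ x.2 then 1 / 2 + c * |x.2 - g x.1| ^ (κ - 1)
  else 1 / 2 - c * |x.2 - g x.1| ^ (κ - 1)

lemma abs_noiseEta_sub_half (hc : 0 < c) (x : FeatureSpace d) :
    |noiseEta c κ g x - 1 / 2| = c * |x.2 - g x.1| ^ (κ - 1) := by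
  have h : 0 ≤ c * |x.2 - g x.1| ^ (κ - 1) := by positivity
  rw [noiseEta]
  split_ifs
  · rw [add_sub_cancel_left, abs_of_nonneg h]
  · rw [sub_sub_cancel_left, abs_neg, abs_of_nonneg h]

lemma half_le_noiseEta_iff (hc : 0 < c) (x : FeatureSpace d) :
    1 / 2 ≤ noiseEta c κ g x ↔ g x.1 ≤ x.2 := by
  rw [noiseEta]
  split_ifs with h
  · simp only [h, iff_true, le_add_iff_nonneg_right]
    positivity
  · have hne : 0 < |x.2 - g x.1| := abs_pos.2 (sub_ne_zero.2 fun heq => h heq.ge)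
    simp only [h, iff_false, not_le, sub_lt_self_iff]
    positivity

lemma measurable_noiseEta (hg : Measurable g) : Measurable (noiseEta c κ g) := by
  have hgx : Measurable fun x : FeatureSpace d => g x.1 := hg.comp measurable_fst
  have hdist : Measurable fun x : FeatureSpace d => c * |x.2 - g x.1| ^ (κ - 1) :=
    measurable_const.mul ((measurable_snd.sub hgx).abs.pow_const (κ - 1))
  exact Measurable.ite (measurableSet_le hgx measurable_snd) (measurable_const.add hdist)
    (measurable_const.sub hdist)

lemma noiseEta_mem_Icc {x : FeatureSpace d} {r : ℝ} (hc : 0 < c) (hκ : 1 ≤ κ)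
    (hr : c * r ^ (κ - 1) ≤ 1 / 2) (hx : |x.2 - g x.1| ≤ r) :
    noiseEta c κ g x ∈ Icc (0 : ℝ) 1 := by
  have hdist : |noiseEta c κ g x - 1 / 2| ≤ 1 / 2 := by
    rw [abs_noiseEta_sub_half hc]
    refine le_trans ?_ hr
    gcongr
  have h := abs_le.1 hdist
  constructor <;> linarith

lemma exists_mem_problemClass_eta_eq_noiseEta {lam α M Δ₀ κ' : ℝ} {μ : Measure (FeatureSpace d)}
    [IsProbabilityMeasure μ] (hμ : μ (unitCube d)ᶜ = 0) (hc : 0 < c)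
    (hg : g ∈ HolderClass (d - 1) lam α) (hgm : Measurable g)
    (heta : ∀ x ∈ unitCube d, noiseEta c κ g x ∈ Icc (0 : ℝ) 1)
    (hmargin : ∀ Δ ∈ Icc 0 Δ₀, ∫ x in {x | x ∈ unitCube d ∧ |x.2 - g x.1| ≤ Δ},
      |1 - 2 * noiseEta c κ g x| ∂μ ≤ M * Δ ^ κ') :
    ∃ P ∈ problemClass d lam α c κ M Δ₀ κ', P.marginal = μ ∧ P.eta = noiseEta c κ g :=
  ⟨⟨μ, inferInstance, hμ, noiseEta c κ g, measurable_noiseEta hgm, heta⟩,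
    ⟨g, hg, by simp only [epi, half_le_noiseEta_iff hc],
      fun x _ => (abs_noiseEta_sub_half hc x).ge, hmargin⟩, rfl, rfl⟩

end NoiseEta

section Construction

variable {d L : ℕ} {c κ δ w : ℝ} {s : (Fin (d - 1) → Fin L) → Bool}

/-- The support of the marginal law: the points of height `1/2` over the cell centres and, for
`none`, over the origin, where all the boundaries `boundaryFun δ s` pass. -/
noncomputable def site (d L : ℕ) : Option (Fin (d - 1) → Fin L) → FeatureSpace d
  | none => (0, 1 / 2)
  | some j => ((L : ℝ)⁻¹ • cellCenter j, 1 / 2)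

lemma site_mem_unitCube (hL : 0 < L) (i : Option (Fin (d - 1) → Fin L)) :
    site d L i ∈ unitCube d := by
  have hhalf : (1 / 2 : ℝ) ∈ Icc (0 : ℝ) 1 := ⟨by norm_num, by norm_num⟩
  cases i with
  | none => exact ⟨⟨le_rfl, zero_le_one⟩, hhalf⟩
  | some j =>
    refine ⟨⟨fun k => ?_, fun k => ?_⟩, hhalf⟩
    · simp only [site, cellCenter, Pi.smul_apply, smul_eq_mul, Pi.zero_apply]
      positivity
    · have hj : ((j k : ℕ) : ℝ) + 1 ≤ L := by exact_mod_cast (j k).isLt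
      simp only [site, cellCenter, Pi.smul_apply, smul_eq_mul, Pi.one_apply]
      rw [inv_mul_le_iff₀ (by positivity)]
      linarith

lemma abs_site_some_sub_boundaryFun (hL : 0 < L) (j : Fin (d - 1) → Fin L) :
    |(site d L (some j)).2 - boundaryFun δ s (site d L (some j)).1| = |δ| := by
  simp only [site, boundaryFun_inv_smul_cellCenter hL]
  split_ifs <;> simp

lemma noiseEta_site (hd : 2 ≤ d) (hL : 0 < L) (hκ : 1 < κ) (hδ : 0 < δ)
    (i : Option (Fin (d - 1) → Fin L)) :
    noiseEta c κ (boundaryFun δ s) (site d L i) = siteEta (c * δ ^ (κ - 1)) s i := by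
  cases i with
  | none =>
    simp [noiseEta, site, siteEta, boundaryFun_zero (m := d - 1) (by omega),
      Real.zero_rpow (sub_pos.2 hκ).ne']
  | some j =>
    rw [noiseEta, abs_site_some_sub_boundaryFun hL, abs_of_pos hδ]
    simp only [site, boundaryFun_inv_smul_cellCenter hL]
    cases h : s j <;> simp [siteEta, h, hδ, hδ.le]

lemma setIntegral_abs_one_sub_noiseEta_site_le {M κ' Δ : ℝ} (hd : 2 ≤ d) (hL : 0 < L)
    (hκ : 1 < κ) (hκ' : 0 ≤ κ') (hc : 0 < c) (hM : 0 ≤ M) (hδ : 0 < δ) (hw : w ∈ Icc (0 : ℝ) 1)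
    (hwM : w * (2 * (c * δ ^ (κ - 1))) ≤ M * δ ^ κ') (hΔ : 0 ≤ Δ) :
    ∫ x in {x | x ∈ unitCube d ∧ |x.2 - boundaryFun δ s x.1| ≤ Δ},
      |1 - 2 * noiseEta c κ (boundaryFun δ s) x| ∂discreteMeasure (siteWeight w) (site d L) ≤
        M * Δ ^ κ' := by
  classical
  have : NeZero L := ⟨hL.ne'⟩
  have hε : 0 ≤ c * δ ^ (κ - 1) := by positivity
  rw [setIntegral_discreteMeasure (siteWeight_mem_stdSimplex hw).1, Fintype.sum_option]
  simp only [indicator_apply, noiseEta_site hd hL hκ hδ, abs_one_sub_two_mul_siteEta_some hε,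
    mem_ofPred_eq, abs_site_some_sub_boundaryFun hL, abs_of_pos hδ, site_mem_unitCube hL, true_and,
    ← Finset.sum_mul, sum_siteWeight_some]
  have hnone : |1 - 2 * siteEta (c * δ ^ (κ - 1)) s none| = 0 := by simp [siteEta]
  rw [hnone, ite_self, mul_zero, zero_add]
  split_ifs with h
  · exact hwM.trans (by gcongr)
  · rw [mul_zero]
    positivity

lemma exists_mem_problemClass_eta_site {lam α M Δ₀ κ' : ℝ} (hd : 2 ≤ d) (hL : 0 < L)
    (hκ : 1 < κ) (hκ' : 0 ≤ κ') (hc : 0 < c) (hM : 0 ≤ M) (hδ : 0 < δ)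
    (hcδ : c * (1 / 2 + δ) ^ (κ - 1) ≤ 1 / 2) (hw : w ∈ Icc (0 : ℝ) 1)
    (hwM : w * (2 * (c * δ ^ (κ - 1))) ≤ M * δ ^ κ')
    (hs : boundaryFun δ s ∈ HolderClass (d - 1) lam α) :
    ∃ P ∈ problemClass d lam α c κ M Δ₀ κ',
      P.marginal = discreteMeasure (siteWeight w) (site d L) ∧
      ∀ i, P.eta (site d L i) = siteEta (c * δ ^ (κ - 1)) s i := by
  have : NeZero L := ⟨hL.ne'⟩
  have : IsProbabilityMeasure (discreteMeasure (siteWeight w) (site d L)) :=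
    isProbabilityMeasure_discreteMeasure (siteWeight_mem_stdSimplex hw)
  have hsupp : discreteMeasure (siteWeight w) (site d L) (unitCube d)ᶜ = 0 := by
    simp [discreteMeasure_apply, site_mem_unitCube hL]
  have hdist (x : FeatureSpace d) (hx : x ∈ unitCube d) :
      |x.2 - boundaryFun δ s x.1| ≤ 1 / 2 + δ := by
    have hbd := abs_le.1 (abs_boundaryFun_sub_half_le (δ := δ) (s := s) x.1)
    rw [abs_of_pos hδ] at hbd
    obtain ⟨hx0, hx1⟩ := hx.2
    rw [abs_le]
    constructor <;> linarith
  obtain ⟨P, hPmem, hPm, hPeta⟩ := exists_mem_problemClass_eta_eq_noiseEta (M := M) (Δ₀ := Δ₀)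
    (κ' := κ') hsupp hc hs (contDiff_boundaryFun 0).continuous.measurable
    (fun x hx => noiseEta_mem_Icc hc hκ.le hcδ (hdist x hx))
    fun Δ hΔ => setIntegral_abs_one_sub_noiseEta_site_le hd hL hκ hκ' hc hM hδ hw hwM hΔ.1
  exact ⟨P, hPmem, hPm, fun i => by rw [hPeta, noiseEta_site hd hL hκ hδ]⟩

end Construction

section Rate

variable {d : ℕ} {lam α c κ M κ' : ℝ}

lemma ofReal_mul_rpow_le_iSup_problemClass {L n : ℕ} {δ W : ℝ} (Δ₀ : ℝ) (hd : 2 ≤ d) (hL : 0 < L)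
    (hκ : 1 < κ) (hκ' : κ - 1 ≤ κ') (hc : 0 < c) (hδ : δ ∈ Ioc (0 : ℝ) 1)
    (hcδ : c * (1 / 2 + δ) ^ (κ - 1) ≤ 1 / 2) (hW : W ∈ Icc (0 : ℝ) 1) (hWM : 2 * c * W ≤ M)
    (hn : 16 * c ^ 2 * W * (n * δ ^ (κ + κ' - 1)) ≤ (L : ℝ) ^ (d - 1))
    (hs : ∀ s : (Fin (d - 1) → Fin L) → Bool, boundaryFun δ s ∈ HolderClass (d - 1) lam α)
    (f : (Fin n → FeatureSpace d × Bool) → FeatureSpace d → Bool) :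
    ENNReal.ofReal (W * c / 4 * δ ^ κ') ≤
      ⨆ P ∈ problemClass d lam α c κ M Δ₀ κ', expectedExcessRisk P f := by
  have : NeZero L := ⟨hL.ne'⟩
  obtain ⟨hδ0, hδ1⟩ := hδ
  obtain ⟨hW0, hW1⟩ := hW
  set ε := c * δ ^ (κ - 1) with hεdef
  set w := W * δ ^ (κ' - (κ - 1)) with hwdef
  have hw : w ∈ Icc (0 : ℝ) 1 := ⟨by positivity,
    mul_le_one₀ hW1 (by positivity) (Real.rpow_le_one hδ0.le hδ1 (sub_nonneg.2 hκ'))⟩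
  have hε : ε ∈ Ioc (0 : ℝ) (1 / 2) := ⟨by positivity,
    le_trans (by rw [hεdef]; gcongr; linarith) hcδ⟩
  have hwε : w * ε = W * c * δ ^ κ' := by
    rw [hwdef, hεdef, mul_mul_mul_comm, ← Real.rpow_add hδ0, sub_add_cancel]
  have hwε2 : w * ε ^ 2 = W * c ^ 2 * δ ^ (κ + κ' - 1) := by
    rw [sq, ← mul_assoc, hwε, hεdef, mul_mul_mul_comm, ← Real.rpow_add hδ0]
    ring_nf
  have hwM : w * (2 * ε) ≤ M * δ ^ κ' :=
    calc w * (2 * ε) = 2 * c * W * δ ^ κ' := by linear_combination 2 * hwε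
      _ ≤ M * δ ^ κ' := by gcongr
  have hcard : 16 * (n * (w * ε ^ 2)) ≤ Fintype.card (Fin (d - 1) → Fin L) := by
    simp only [hwε2, Fintype.card_pi, Finset.prod_const, Finset.card_univ, Fintype.card_fin,
      Nat.cast_pow]
    linarith
  have hM : 0 ≤ M := le_trans (by positivity) hWM
  have hbound := ofReal_le_iSup_expectedExcessRisk (site_mem_unitCube hL) hw hε hcard
    (fun s => exists_mem_problemClass_eta_site (Δ₀ := Δ₀) hd hL hκ (by linarith) hc hM hδ0 hcδ hw
      hwM (hs s)) f
  rwa [hwε, mul_div_right_comm] at hbound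

lemma exists_pos_le_mul_half_add_rpow_le_half (hκ : 1 < κ) (hc' : c < 2 ^ (κ - 2)) {A₀ : ℝ}
    (hA₀ : 0 < A₀) : ∃ A > 0, A ≤ A₀ ∧ c * (1 / 2 + A) ^ (κ - 1) < 1 / 2 := by
  have hzero : c * (1 / 2 + 0 : ℝ) ^ (κ - 1) < 1 / 2 :=
    calc c * (1 / 2 + 0 : ℝ) ^ (κ - 1) < 2 ^ (κ - 2) * (1 / 2 : ℝ) ^ (κ - 1) := by
          rw [add_zero]
          gcongr
      _ = 1 / 2 := by
          rw [one_div, Real.inv_rpow zero_le_two, ← Real.rpow_neg zero_le_two,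
            ← Real.rpow_add zero_lt_two, show κ - 2 + -(κ - 1) = -1 by ring, Real.rpow_neg_one]
  have hcont : Continuous fun A : ℝ => c * (1 / 2 + A) ^ (κ - 1) :=
    continuous_const.mul ((continuous_const.add continuous_id).rpow_const
      fun _ => Or.inr (sub_nonneg.2 hκ.le))
  have hnear : ∀ᶠ A in 𝓝[>] (0 : ℝ), c * (1 / 2 + A) ^ (κ - 1) < 1 / 2 :=
    nhdsWithin_le_nhds (hcont.continuousAt.eventually_lt continuousAt_const hzero)
  obtain ⟨A, hA, hA0, hAA₀⟩ := (hnear.and (Ioc_mem_nhdsGT hA₀)).exists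
  exact ⟨A, hA0, hAA₀, hA⟩

lemma exists_ofReal_mul_rpow_neg_le_iSup_problemClass (Δ₀ : ℝ) (hd : 2 ≤ d) (hlam : 0 < lam)
    (hα : 0 < α) (hκ : 1 < κ) (hκ' : κ - 1 ≤ κ') (hc : 0 < c) (hc' : c < 2 ^ (κ - 2))
    (hM : 0 < M) :
    ∃ C > 0, ∀ L : ℕ, 0 < L → ∀ n : ℕ, n ≤ (L : ℝ) ^ (α * (κ + κ' - 1) + (d - 1)) →
      ∀ f : (Fin n → FeatureSpace d × Bool) → FeatureSpace d → Bool,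
        ENNReal.ofReal (C * (L : ℝ) ^ (-(α * κ'))) ≤
          ⨆ P ∈ problemClass d lam α c κ M Δ₀ κ', expectedExcessRisk P f := by
  obtain ⟨A₀, hA₀, hHolder⟩ := exists_boundaryFun_mem_HolderClass (d - 1) hlam hα
  obtain ⟨A, hA, hAA₀, hcA⟩ := exists_pos_le_mul_half_add_rpow_le_half hκ hc' (lt_min hA₀ one_pos)
  obtain ⟨W, hW0, hW⟩ : ∃ W > 0, W ≤ min 1 (min (M / (2 * c)) (1 / (16 * c ^ 2))) :=
    ⟨_, by positivity, le_rfl⟩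
  rw [le_min_iff, le_min_iff, le_div_iff₀' (by positivity), le_div_iff₀' (by positivity)] at hW
  obtain ⟨hW1, hWM, hWc⟩ := hW
  refine ⟨W * c / 4 * A ^ κ', by positivity, fun L hL n hn f => ?_⟩
  have hL0 : (0 : ℝ) < L := by exact_mod_cast hL
  have hLα : (L : ℝ) ^ (-α) ≤ 1 :=
    Real.rpow_le_one_of_one_le_of_nonpos (by exact_mod_cast hL) (by linarith)
  have hδA : A * (L : ℝ) ^ (-α) ≤ A := mul_le_of_le_one_right hA.le hLα
  have hA1 : A ≤ 1 := hAA₀.trans (min_le_right _ _)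
  have hsamples : 16 * c ^ 2 * W * (n * (A * (L : ℝ) ^ (-α)) ^ (κ + κ' - 1)) ≤ (L : ℝ) ^ (d - 1) :=
    calc 16 * c ^ 2 * W * (n * (A * (L : ℝ) ^ (-α)) ^ (κ + κ' - 1))
        ≤ 1 * ((L : ℝ) ^ (α * (κ + κ' - 1) + (d - 1)) * (1 * (L : ℝ) ^ (-α)) ^ (κ + κ' - 1)) := by
          gcongr
          linarith
      _ = (L : ℝ) ^ (d - 1) := by
          rw [one_mul, one_mul, ← Real.rpow_mul hL0.le, ← Real.rpow_add hL0, ← Real.rpow_natCast,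
            Nat.cast_pred (by omega)]
          ring_nf
  have hbound := ofReal_mul_rpow_le_iSup_problemClass Δ₀ hd hL hκ hκ' hc
    ⟨by positivity, hδA.trans hA1⟩ (le_trans (by gcongr) hcA.le) ⟨hW0.le, hW1⟩ hWM hsamples
    (hHolder A hA.le (hAA₀.trans (min_le_left _ _)) L hL) f
  rwa [Real.mul_rpow hA.le (by positivity), ← Real.rpow_mul hL0.le, neg_mul, ← mul_assoc] at hbound

lemma exists_nat_le_rpow_and_le_two_mul_rpow_inv {x r : ℝ} (hx : 1 ≤ x) (hr : 0 < r) :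
    ∃ L : ℕ, 0 < L ∧ x ≤ (L : ℝ) ^ r ∧ (L : ℝ) ≤ 2 * x ^ r⁻¹ := by
  have hroot : 1 ≤ x ^ r⁻¹ := Real.one_le_rpow hx (by positivity)
  refine ⟨⌈x ^ r⁻¹⌉₊, Nat.ceil_pos.2 (by linarith), ?_, ?_⟩
  · calc x = (x ^ r⁻¹) ^ r := (Real.rpow_inv_rpow (by linarith) hr.ne').symm
      _ ≤ _ := by gcongr; exact Nat.le_ceil _
  · linarith [Nat.ceil_lt_add_one (by linarith : 0 ≤ x ^ r⁻¹)]

lemma exists_ofReal_mul_rpow_neg_passiveExponent_le (Δ₀ : ℝ) (hd : 2 ≤ d) (hlam : 0 < lam)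
    (hα : 0 < α) (hκ : 1 < κ) (hκ' : κ - 1 ≤ κ') (hc : 0 < c) (hc' : c < 2 ^ (κ - 2))
    (hM : 0 < M) :
    ∃ C > 0, ∀ n ≥ 1, ∀ f : (Fin n → FeatureSpace d × Bool) → FeatureSpace d → Bool,
      ENNReal.ofReal (C * (n : ℝ) ^ (-passiveExponent d α κ κ')) ≤
        ⨆ P ∈ problemClass d lam α c κ M Δ₀ κ', expectedExcessRisk P f := by
  obtain ⟨C, hC, hbound⟩ :=
    exists_ofReal_mul_rpow_neg_le_iSup_problemClass Δ₀ hd hlam hα hκ hκ' hc hc' hM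
  refine ⟨C * 2 ^ (-(α * κ')), by positivity, fun n hn f => ?_⟩
  have hd' : (2 : ℝ) ≤ d := by exact_mod_cast hd
  have hr : 0 < α * (κ + κ' - 1) + (d - 1) :=
    add_pos_of_nonneg_of_pos (mul_nonneg hα.le (by linarith)) (by linarith)
  obtain ⟨L, hL, hnL, hLn⟩ :=
    exists_nat_le_rpow_and_le_two_mul_rpow_inv (x := n) (by exact_mod_cast hn) hr
  refine (ENNReal.ofReal_le_ofReal ?_).trans (hbound L hL n hnL f)
  have hακ' : 0 ≤ α * κ' := mul_nonneg hα.le (by linarith)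
  rw [mul_assoc]
  gcongr
  calc (2 : ℝ) ^ (-(α * κ')) * (n : ℝ) ^ (-passiveExponent d α κ κ')
      = (2 * (n : ℝ) ^ (α * (κ + κ' - 1) + (d - 1))⁻¹) ^ (-(α * κ')) := by
        rw [Real.mul_rpow zero_le_two (by positivity), ← Real.rpow_mul n.cast_nonneg,
          passiveExponent, inv_mul_eq_div, neg_div]
    _ ≤ (L : ℝ) ^ (-(α * κ')) :=
        Real.rpow_le_rpow_of_nonpos (by exact_mod_cast hL) hLn (neg_nonpos.2 hακ')

lemma passiveExponent_lt_activeExponent (hd : 2 ≤ d) (hα : 0 < α) (hκ : 1 < κ)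
    (hκ' : κ - 1 < κ') : passiveExponent d α κ κ' < activeExponent d α κ κ' := by
  have hd' : (2 : ℝ) ≤ d := by exact_mod_cast hd
  have hακ : 0 < α * (κ - 1) := mul_pos hα (by linarith)
  have hακ' : α * (κ - 1) < α * κ' := by gcongr
  exact div_lt_div_of_pos_left (by linarith) (by linarith) (by linarith)

end Rate

lemma isLittleO_log_rpow_mul_rpow_neg {a b : ℝ} (hab : a < b) (q : ℝ) :
    (fun n : ℕ => Real.log n ^ q * (n : ℝ) ^ (-b)) =o[atTop] fun n : ℕ => (n : ℝ) ^ (-a) := by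
  have hlog := (isLittleO_log_rpow_rpow_atTop q (sub_pos.2 hab)).comp_tendsto
    tendsto_natCast_atTop_atTop (α := ℝ)
  refine (hlog.mul_isBigO (isBigO_refl (fun n : ℕ => (n : ℝ) ^ (-b)) atTop)).congr'
    EventuallyEq.rfl ?_
  filter_upwards [eventually_gt_atTop 0] with n hn
  rw [Function.comp_apply, ← Real.rpow_add (by exact_mod_cast hn)]
  ring_nf

theorem theorem6_general (d : ℕ) (hd : 2 ≤ d) (lam α c κ M Δ₀ κ' : ℝ)
    (hlam : 0 < lam) (hα : 0 < α) (hκ : 1 < κ) (hκ' : κ - 1 < κ')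
    (hc : 0 < c) (hc' : c < 2 ^ (κ - 2)) (hM : 0 < M) :
    (∃ C > 0, ∀ n ≥ 1, ∀ f : (Fin n → FeatureSpace d × Bool) → FeatureSpace d → Bool,
      ENNReal.ofReal (C * (n : ℝ) ^ (-passiveExponent d α κ κ')) ≤
        ⨆ P ∈ problemClass d lam α c κ M Δ₀ κ', expectedExcessRisk P f) ∧
    passiveExponent d α κ κ' < activeExponent d α κ κ' ∧
    ∀ q : ℝ, (fun n : ℕ => Real.log n ^ q * (n : ℝ) ^ (-activeExponent d α κ κ'))
      =o[atTop] fun n : ℕ => (n : ℝ) ^ (-passiveExponent d α κ κ') :=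
  have hexponent := passiveExponent_lt_activeExponent hd hα hκ hκ'
  ⟨exists_ofReal_mul_rpow_neg_passiveExponent_le Δ₀ hd hlam hα hκ hκ'.le hc hc' hM, hexponent,
    isLittleO_log_rpow_mul_rpow_neg hexponent⟩

theorem theorem6 (d : ℕ) (hd : 2 ≤ d) (lam α c κ M Δ₀ κ' : ℝ)
    (hlam : 1 ≤ lam) (hα : 0 < α) (hκ : 1 < κ) (hκ' : κ - 1 < κ')
    (hc : 0 < c) (hc' : c < 2 ^ (κ - 2)) (hM : 0 < M) (hΔ₀ : 0 < Δ₀) :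
    (∃ C : ℝ, 0 < C ∧ ∃ N : ℕ, ∀ n : ℕ, N ≤ n →
      ENNReal.ofReal (C * (n : ℝ) ^ (-passiveExponent d α κ κ')) ≤
        passiveMinimaxRisk (problemClass d lam α c κ M Δ₀ κ') n) ∧
    passiveExponent d α κ κ' < activeExponent d α κ κ' ∧
    ∀ q : ℝ, (fun n : ℕ => Real.log n ^ q * (n : ℝ) ^ (-activeExponent d α κ κ'))
      =o[atTop] fun n : ℕ => (n : ℝ) ^ (-passiveExponent d α κ κ') :=
  (theorem6_general d hd lam α c κ M Δ₀ κ' (one_pos.trans_le hlam) hα hκ hκ' hc hc' hM).imp_left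
    fun ⟨C, hC, hbound⟩ => ⟨C, hC, 1, fun n hn => le_iInf₂ fun f _ => hbound n hn f⟩
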